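/- Let $K$ be the number of arms, $T$ the number of epochs, $s_a>0$ ($1\le a\le K$) the measurement standard deviations, $b_t>0$ ($0\le t<T$) the batch-size constants, $h\in\mathbb R^K$ a fixed vector of (scaled) average rewards, and $(\mu_0,\sigma_0)\in\mathbb R^K\times(0,\infty)^K$ a fixed prior. Let $\pi_t:\mathbb R^K\times(0,\infty)^K\to\Delta_K$ ($0\le t<T$) be continuous maps into the probability simplex (a policy continuous in the posterior state). Given observations $r_0,r_1,\ldots\in\mathbb R^K$, define posterior states recursively from $(\mu_0,\sigma_0)$ by $$\sigma_{t+1,a}^{-2}=\sigma_{t,a}^{-2}+s_a^{-2}b_t\,\pi_{t,a}(\mu_t,\sigma_t),\qquad \mu_{t+1,a}=\sigma_{t+1,a}^{2}\left(\sigma_{t,a}^{-2}\mu_{t,a}+s_a^{-2}b_t\,r_{t,a}\right).$$ *Pre-limit experiment.* For each scaling $n\in\mathbb N$, epoch $t$ has $\lfloor b_tn\rfloor$ units. If unit $j$ of epoch $t$ is assigned to arm $a$ (written $\xi^t_{a,j}=1$; each unit is assigned to exactly one arm), its reward is $R^t_{a,j}=h_a/\sqrt n+\epsilon^t_{a,j}$.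 Put $\sqrt n\,\bar R^n_{t,a}=\frac1{b_t\sqrt n}\sum_{j=1}^{\lfloor b_tn\rfloor}\xi^t_{a,j}R^t_{a,j}$, and let $(\mu_{n,t},\sigma_{n,t})$ be the posterior states computed from $r_t=\sqrt n\,\bar R^n_t$. Conditionally on $\bar R^n_0,\ldots,\bar R^n_{t-1}$, the units of epoch $t$ are i.i.d., each is assigned to an arm drawn from $\pi_t(\mu_{n,t},\sigma_{n,t})$, its noise vector $\epsilon^t_j=(\epsilon^t_{a,j})_a$ has a fixed law, and its assignment is independent of its noise vector. The noise law does not depend on $n$, $t$, $j$ and satisfies $\mathbb E\epsilon_a=0$, $\mathrm{Var}(\epsilon_a)=s_a^2$ and $\mathbb E\|\epsilon\|_2^4<\infty$. *Limit experiment.* Let $G_0,\ldots,G_{T-1}$ be the Gaussian sequential experiment with the same $h$: with $(\mu_t,\sigma_t)$ the posterior states computed from $r_t=G_t$, the conditional law of $G_t$ given $G_0,\ldots,G_{t-1}$ is $N\big((p_ah_a)_a,\ \mathrm{diag}(p_as_a^2/b_t)_a\big)$, where $p=\pi_t(\mu_t,\sigma_t)$. Then, as $n\to\infty$, jointly over epochs,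 $$(\mu_{n,0},\sigma_{n,0},\ldots,\mu_{n,T-1},\sigma_{n,T-1})\ \xrightarrow{d}\ (\mu_0,\sigma_0,\ldots,\mu_{T-1},\sigma_{T-1}).$$ -/

import Mathlib

open MeasureTheory ProbabilityTheory Filter

namespace BatchedExperiment

noncomputable section

/-- The positive reals, with the topology and the Borel σ-algebra inherited from `ℝ`. -/
abbrev PosReal : Type := {x : ℝ // 0 < x}

/-- Posterior states `(μ, σ)` of `K` arms: a vector of means and a vector of (positive) standard
deviations. -/
abbrev State (K : ℕ) : Type := (Fin K → ℝ) × (Fin K → PosReal)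

/-- A policy that depends continuously on the posterior state: in epoch `t` it maps a state to an
allocation, i.e. a point of the probability simplex over the `K` arms. -/
abbrev ContinuousPolicy (K : ℕ) : Type := ℕ → C(State K, stdSimplex ℝ (Fin K))

variable {K : ℕ}

/-! ### Posterior updates -/

/-- The updated posterior standard deviation `σ'`, i.e. `σ'⁻² = σ⁻² + s⁻² β p`, for measurement
standard deviation `s`, batch-size constant `β` and sampling probability `p`. -/
def nextSd (s β σ : PosReal) (p : ℝ) (hp : 0 ≤ p) : PosReal :=
  ⟨(√(((σ : ℝ) ^ 2)⁻¹ + ((s : ℝ) ^ 2)⁻¹ * β * p))⁻¹, by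
    have h1 := σ.2
    have h2 := s.2
    have h3 := β.2
    positivity⟩

/-- The defining relation of the posterior variance. -/
theorem nextSd_spec (s β σ : PosReal) (p : ℝ) (hp : 0 ≤ p) :
    ((nextSd s β σ p hp : ℝ) ^ 2)⁻¹ = ((σ : ℝ) ^ 2)⁻¹ + ((s : ℝ) ^ 2)⁻¹ * β * p := by
  have h1 := σ.2
  have h2 := s.2
  have h3 := β.2
  simp only [nextSd, inv_pow, inv_inv]
  exact Real.sq_sqrt (by positivity)

/-- One posterior update from the state `x = (μ, σ)` after a batch with allocation `p` and
(scaled) aggregate observation `g`: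
`σ'ₐ⁻² = σₐ⁻² + sₐ⁻² β pₐ` and `μ'ₐ = σ'ₐ² (σₐ⁻² μₐ + sₐ⁻² β gₐ)`. -/
def update (s : Fin K → PosReal) (β : PosReal) (p : stdSimplex ℝ (Fin K)) (x : State K)
    (g : Fin K → ℝ) : State K :=
  (fun a => (nextSd (s a) β (x.2 a) (p.1 a) (p.2.1 a) : ℝ) ^ 2 *
      (((x.2 a : ℝ) ^ 2)⁻¹ * x.1 a + ((s a : ℝ) ^ 2)⁻¹ * β * g a),
    fun a => nextSd (s a) β (x.2 a) (p.1 a) (p.2.1 a))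

/-- The posterior state at the beginning of epoch `t`, as a function of the observations
`r 0, …, r (t - 1)`, when the prior is `x₀ = (μ₀, σ₀)` and the allocations are
`π 0, …, π (t - 1)` evaluated at the current posterior states. -/
def posterior (s : Fin K → PosReal) (b : ℕ → PosReal) (π : ContinuousPolicy K) (x₀ : State K) :
    (t : ℕ) → (Fin t → Fin K → ℝ) → State K
  | 0, _ => x₀
  | t + 1, r =>
      let x := posterior s b π x₀ t (Fin.init r)
      update s (b t) (π t x) x (r (Fin.last t))

theorem continuous_posterior (s : Fin K → PosReal) (b : ℕ → PosReal) (π : ContinuousPolicy K)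
    (x₀ : State K) (t : ℕ) : Continuous (posterior s b π x₀ t) := by
  induction t with
  | zero => exact continuous_const
  | succ t ih =>
    have hx : Continuous fun r : Fin (t + 1) → Fin K → ℝ => posterior s b π x₀ t (Fin.init r) :=
      ih.comp (continuous_pi fun i => continuous_apply i.castSucc)
    have hp : Continuous fun r : Fin (t + 1) → Fin K → ℝ =>
        π t (posterior s b π x₀ t (Fin.init r)) := (π t).continuous.comp hx
    have hσ : ∀ a, Continuous fun r : Fin (t + 1) → Fin K → ℝ =>
        ((posterior s b π x₀ t (Fin.init r)).2 a : ℝ) := fun a =>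
      continuous_subtype_val.comp ((continuous_apply a).comp (continuous_snd.comp hx))
    have hpa : ∀ a, Continuous fun r : Fin (t + 1) → Fin K → ℝ =>
        (π t (posterior s b π x₀ t (Fin.init r))).1 a := fun a =>
      (continuous_apply a).comp (continuous_subtype_val.comp hp)
    have hnext : ∀ a, Continuous fun r : Fin (t + 1) → Fin K → ℝ =>
        nextSd (s a) (b t) ((posterior s b π x₀ t (Fin.init r)).2 a)
          ((π t (posterior s b π x₀ t (Fin.init r))).1 a)
          ((π t (posterior s b π x₀ t (Fin.init r))).2.1 a) := by
      intro a
      refine Continuous.subtype_mk (Continuous.inv₀ (Real.continuous_sqrt.comp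
        ((((hσ a).pow 2).inv₀ fun r => ?_).add (continuous_const.mul (hpa a)))) fun r => ?_) _
      · exact (pow_pos (Subtype.prop _) 2).ne'
      · exact (inv_pos.1 (nextSd (s a) (b t) ((posterior s b π x₀ t (Fin.init r)).2 a)
          ((π t (posterior s b π x₀ t (Fin.init r))).1 a)
          ((π t (posterior s b π x₀ t (Fin.init r))).2.1 a)).2).ne'
    refine Continuous.prodMk (continuous_pi fun a => ?_) (continuous_pi hnext)
    refine ((continuous_subtype_val.comp (hnext a)).pow 2).mul
      (((((hσ a).pow 2).inv₀ fun r => ?_).mul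
        ((continuous_apply a).comp (continuous_fst.comp hx))).add
        (continuous_const.mul ((continuous_apply a).comp (continuous_apply (Fin.last t)))))
    exact (pow_pos (Subtype.prop _) 2).ne'

/-! ### Transition kernels -/

/-- The product kernel `x ↦ ⨂ᵢ κᵢ(x)` of finitely many Markov kernels: given `x`, the coordinates
are independent and the `i`-th one has law `κᵢ(x)`. -/
def piKernel {α ι : Type*} [MeasurableSpace α] [Fintype ι] {β : ι → Type*}
    [∀ i, MeasurableSpace (β i)] (κ : (i : ι) → Kernel α (β i)) [∀ i, IsMarkovKernel (κ i)] :
    Kernel α ((i : ι) → β i) where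
  toFun x := Measure.pi fun i => κ i x
  measurable' := by
    refine Measurable.measure_of_isPiSystem_of_isProbabilityMeasure
      generateFrom_pi.symm isPiSystem_pi ?_
    rintro _ ⟨S, hS, rfl⟩
    simp only [Measure.pi_pi]
    exact Finset.measurable_prod _ fun i _ => (κ i).measurable_coe (hS i (Set.mem_univ i))

instance {α ι : Type*} [MeasurableSpace α] [Fintype ι] {β : ι → Type*}
    [∀ i, MeasurableSpace (β i)] (κ : (i : ι) → Kernel α (β i)) [∀ i, IsMarkovKernel (κ i)] :
    IsMarkovKernel (piKernel κ) :=
  ⟨fun x => inferInstanceAs (IsProbabilityMeasure (Measure.pi fun i => κ i x))⟩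

/-- The law on the arms in which arm `a` has probability `p a`. -/
def armLaw (p : stdSimplex ℝ (Fin K)) : Measure (Fin K) :=
  ∑ a, ENNReal.ofReal (p.1 a) • Measure.dirac a

instance (p : stdSimplex ℝ (Fin K)) : IsProbabilityMeasure (armLaw p) where
  measure_univ := by
    simp only [armLaw, Measure.coe_finsetSum, Finset.sum_apply, Measure.smul_apply, measure_univ,
      smul_eq_mul, mul_one]
    rw [← ENNReal.ofReal_sum_of_nonneg fun a _ => p.2.1 a, p.2.2, ENNReal.ofReal_one]

theorem measurable_armLaw : Measurable (armLaw (K := K)) := by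
  refine Measure.measurable_of_measurable_coe _ fun S hS => ?_
  simp only [armLaw, Measure.coe_finsetSum, Finset.sum_apply, Measure.smul_apply, smul_eq_mul]
  exact Finset.measurable_sum _ fun a _ => (ENNReal.measurable_ofReal.comp
    ((measurable_pi_apply a).comp measurable_subtype_coe)).mul_const _

/-- The allocation of epoch `t` as a function of the observations made before epoch `t`. -/
def allocation (s : Fin K → PosReal) (b : ℕ → PosReal) (π : ContinuousPolicy K) (x₀ : State K)
    (t : ℕ) (r : Fin t → Fin K → ℝ) : stdSimplex ℝ (Fin K) :=
  π t (posterior s b π x₀ t r)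

theorem measurable_allocation (s : Fin K → PosReal) (b : ℕ → PosReal) (π : ContinuousPolicy K)
    (x₀ : State K) (t : ℕ) : Measurable (allocation s b π x₀ t) :=
  ((π t).continuous.comp (continuous_posterior s b π x₀ t)).measurable

/-- Law of the arm assigned to one unit of epoch `t`, given the observations made before. -/
def armKernel (s : Fin K → PosReal) (b : ℕ → PosReal) (π : ContinuousPolicy K) (x₀ : State K)
    (t : ℕ) : Kernel (Fin t → Fin K → ℝ) (Fin K) where
  toFun r := armLaw (allocation s b π x₀ t r)
  measurable' := measurable_armLaw.comp (measurable_allocation s b π x₀ t)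

instance (s : Fin K → PosReal) (b : ℕ → PosReal) (π : ContinuousPolicy K) (x₀ : State K)
    (t : ℕ) : IsMarkovKernel (armKernel s b π x₀ t) :=
  ⟨fun r => inferInstanceAs (IsProbabilityMeasure (armLaw (allocation s b π x₀ t r)))⟩

/-- Law of the pair (assigned arm, noise vector) of one unit of epoch `t`, given the observations
made before: the arm is drawn from the allocation, independently of the noise vector, which has
law `ν`. -/
def unitKernel (s : Fin K → PosReal) (b : ℕ → PosReal) (π : ContinuousPolicy K) (x₀ : State K)
    (ν : Measure (Fin K → ℝ)) (t : ℕ) : Kernel (Fin t → Fin K → ℝ) (Fin K × (Fin K → ℝ)) :=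
  (armKernel s b π x₀ t).prod (Kernel.const _ ν)

instance (s : Fin K → PosReal) (b : ℕ → PosReal) (π : ContinuousPolicy K) (x₀ : State K)
    (ν : Measure (Fin K → ℝ)) [IsProbabilityMeasure ν] (t : ℕ) :
    IsMarkovKernel (unitKernel s b π x₀ ν t) := by
  unfold unitKernel; infer_instance

/-- The law `N(pₐ hₐ, pₐ sₐ² / b t)` with `p` the allocation of epoch `t`, given the observations
made before (a point mass if `pₐ = 0`). -/
def gaussianArmKernel (s : Fin K → PosReal) (b : ℕ → PosReal) (π : ContinuousPolicy K)
    (x₀ : State K) (h : Fin K → ℝ) (t : ℕ) (a : Fin K) : Kernel (Fin t → Fin K → ℝ) ℝ where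
  toFun r := gaussianReal ((allocation s b π x₀ t r).1 a * h a)
    ((allocation s b π x₀ t r).1 a * (s a : ℝ) ^ 2 / b t).toNNReal
  measurable' := by
    have hp : Measurable fun r => (allocation s b π x₀ t r).1 a :=
      (measurable_pi_apply a).comp (measurable_subtype_coe.comp (measurable_allocation s b π x₀ t))
    exact measurable_gaussianReal.comp
      ((hp.mul_const _).prodMk ((hp.mul_const _).div_const _).real_toNNReal)

instance (s : Fin K → PosReal) (b : ℕ → PosReal) (π : ContinuousPolicy K) (x₀ : State K)
    (h : Fin K → ℝ) (t : ℕ) (a : Fin K) : IsMarkovKernel (gaussianArmKernel s b π x₀ h t a) :=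
  ⟨fun _ => inferInstanceAs (IsProbabilityMeasure (gaussianReal _ _))⟩

/-! ### The batched experiment and its Gaussian limit -/

/-- Number of units in epoch `t` at scaling `n`: `b t * n`, rounded down. -/
def batchSize (b : ℕ → PosReal) (n t : ℕ) : ℕ := ⌊(b t : ℝ) * n⌋₊

/-- The reward of a unit at scaling `n` if it is assigned to arm `a`: `hₐ / √n + εₐ`. -/
def reward (h : Fin K → ℝ) (n : ℕ) (ε : Fin K → ℝ) (a : Fin K) : ℝ := h a / √n + ε a

/-- The scaled batch sample mean `√n R̄ₜ`, whose `a`-th entry is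
`(b t √n)⁻¹ ∑ⱼ ξₐⱼ Rₐⱼ` with `ξₐⱼ` the indicator that unit `j` is assigned to arm `a`. The batch
`y` lists the pair (assigned arm, noise vector) of each unit. -/
def scaledMean (b : ℕ → PosReal) (h : Fin K → ℝ) (n t : ℕ)
    (y : Fin (batchSize b n t) → Fin K × (Fin K → ℝ)) (a : Fin K) : ℝ :=
  1 / ((b t : ℝ) * √n) * ∑ j, (if (y j).1 = a then 1 else 0) * reward h n (y j).2 a

/-- Conditions on the law `ν` of the noise vector `ε`: mean zero, `Var εₐ = sₐ²`, and a finite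
fourth moment `𝔼 ‖ε‖₂⁴`. -/
structure IsNoiseLaw (s : Fin K → PosReal) (ν : Measure (Fin K → ℝ)) : Prop where
  mean : ∀ a, ∫ e, e a ∂ν = 0
  variance : ∀ a, Var[fun e => e a; ν] = (s a : ℝ) ^ 2
  moment : Integrable (fun e => ‖WithLp.toLp 2 e‖ ^ 4) ν

/-- `T` epochs of the batched experiment at scaling `n`, run with the policy `π` evaluated at the
pre-limit posterior states. `Y t ω j` is the pair (assigned arm, noise vector) of unit `j` of
epoch `t`. Given the aggregate observations of the epochs before `t`, the units of epoch `t` are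
independent; each is assigned to an arm drawn from the current allocation, has noise of law `ν`,
and its assignment is independent of its (potential) rewards. -/
def IsBatchedExperiment {Ω : Type*} [MeasurableSpace Ω] (s : Fin K → PosReal) (b : ℕ → PosReal)
    (π : ContinuousPolicy K) (x₀ : State K) (h : Fin K → ℝ) (ν : Measure (Fin K → ℝ))
    [IsProbabilityMeasure ν] (T n : ℕ)
    (Y : (t : ℕ) → Ω → Fin (batchSize b n t) → Fin K × (Fin K → ℝ)) (P : Measure Ω) : Prop :=
  ∀ t < T, HasCondDistrib (Y t) (fun ω (i : Fin t) => scaledMean b h n i (Y i ω))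
    (piKernel fun _ => unitKernel s b π x₀ ν t) P

/-- `G 0, …, G (T - 1)` is the Gaussian sequential experiment with average rewards `h` under the
policy `π` evaluated at the posterior states: given `G 0, …, G (t - 1)`, the vector `G t` has law
`N(p h, diag(p s² / b t))` with `p` the allocation of epoch `t`. -/
def IsGaussianExperiment {Ω : Type*} [MeasurableSpace Ω] (s : Fin K → PosReal) (b : ℕ → PosReal)
    (π : ContinuousPolicy K) (x₀ : State K) (h : Fin K → ℝ) (T : ℕ)
    (G : ℕ → Ω → Fin K → ℝ) (P : Measure Ω) : Prop :=
  ∀ t < T, HasCondDistrib (G t) (fun ω (i : Fin t) => G i ω)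
    (piKernel fun a => gaussianArmKernel s b π x₀ h t a) P

end

end BatchedExperiment

/-!
Given the past, the characteristic function of the scaled mean of epoch `t` at scaling `n` is
`(∑ₐ pₐ wₙₐ) ^ mₙ`, where `p` is the current allocation, `mₙ` the batch size and `wₙₐ` the
characteristic function of the contribution of one unit assigned to arm `a`. A second-order
expansion gives `mₙ (wₙₐ - 1) → cₐ`, so by compactness of the simplex these characteristic functions
converge to `exp (∑ₐ pₐ cₐ)`, the one of the Gaussian experiment, uniformly in `p` and therefore
uniformly in the past. Uniform convergence of conditional characteristic functions to a limit that
is continuous in the past carries weak convergence from the past to the past together with the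
present (Lévy), so induction over the epochs gives the joint convergence of the scaled means. The
posterior states are continuous functions of the scaled means.
-/

open scoped Topology

namespace BatchedExperiment

theorem tendsto_integral_of_tendstoUniformly {ι E 𝕜 : Type*} [RCLike 𝕜] [TopologicalSpace E]
    [MeasurableSpace E] [OpensMeasurableSpace E] {l : Filter ι} {μ : ι → ProbabilityMeasure E}
    {μ₀ : ProbabilityMeasure E} (hμ : Tendsto μ l (𝓝 μ₀)) {g : ι → E → 𝕜}
    {f : BoundedContinuousFunction E 𝕜} (hg : ∀ i, Integrable (g i) (μ i : Measure E))
    (h : TendstoUniformly g f l) :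
    Tendsto (fun i => ∫ x, g i x ∂(μ i : Measure E)) l (𝓝 (∫ x, f x ∂(μ₀ : Measure E))) := by
  have hf := (ProbabilityMeasure.tendsto_iff_forall_integral_rclike_tendsto 𝕜).1 hμ f
  refine hf.congr_dist (Metric.tendsto_nhds.2 fun ε hε => ?_)
  filter_upwards [Metric.tendstoUniformly_iff.1 h (ε / 2) (half_pos hε)] with i hi
  have hdist : ‖∫ x, f x - g i x ∂(μ i : Measure E)‖ ≤ ε / 2 := by
    simpa using norm_integral_le_of_norm_le_const (μ := (μ i : Measure E))
      (ae_of_all _ fun x => (dist_eq_norm (f x) (g i x) ▸ hi x).le)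
  rw [Real.dist_0_eq_abs, abs_of_nonneg dist_nonneg, dist_eq_norm,
    ← integral_sub (f.integrable _) (hg i)]
  exact hdist.trans_lt (half_lt_self hε)

section WeakConvergence

variable {E F : Type*} [NormedAddCommGroup E] [NormedSpace ℝ E] [MeasurableSpace E] [BorelSpace E]
  [NormedAddCommGroup F] [NormedSpace ℝ F] [MeasurableSpace F] [BorelSpace F]

theorem norm_charFunDual_le_one (μ : Measure E) [IsProbabilityMeasure μ] (L : StrongDual ℝ E) :
    ‖charFunDual μ L‖ ≤ 1 := by
  have := Measure.isProbabilityMeasure_map (μ := μ) L.continuous.aemeasurable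
  rw [charFunDual_eq_charFun_map_one]
  exact norm_charFun_le_one 1

theorem tendsto_of_tendsto_charFunDual [FiniteDimensional ℝ E] {μ : ℕ → ProbabilityMeasure E}
    {μ₀ : ProbabilityMeasure E}
    (h : ∀ L, Tendsto (fun n => charFunDual (μ n : Measure E) L) atTop
      (𝓝 (charFunDual (μ₀ : Measure E) L))) :
    Tendsto μ atTop (𝓝 μ₀) := by
  -- Lévy's theorem is available on inner product spaces; `e` transports it to `E`.
  let e := toEuclidean (E := E)
  have charFun_map (ρ : ProbabilityMeasure E) (x) :
      charFun (ρ.map e.continuous.aemeasurable : Measure _) x =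
        charFunDual (ρ : Measure E)
          ((InnerProductSpace.toDualMap ℝ _ x).comp e.toContinuousLinearMap) := by
    rw [charFun_eq_charFunDual_toDualMap, ProbabilityMeasure.toMeasure_map]
    exact charFunDual_map e.toContinuousLinearMap _
  have map_symm_map (ρ : ProbabilityMeasure E) :
      (ρ.map e.continuous.aemeasurable).map e.symm.continuous.aemeasurable = ρ := by
    ext1
    simp only [ProbabilityMeasure.toMeasure_map]
    rw [Measure.map_map e.symm.continuous.measurable e.continuous.measurable]
    simp
  have tendsto_map : Tendsto (fun n => (μ n).map e.continuous.aemeasurable) atTop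
      (𝓝 (μ₀.map e.continuous.aemeasurable)) :=
    ProbabilityMeasure.tendsto_of_tendsto_charFun fun x => by simpa only [charFun_map] using h _
  simpa only [map_symm_map] using
    ProbabilityMeasure.tendsto_map_of_tendsto_of_continuous _ _ tendsto_map e.symm.continuous

theorem charFunDual_compProd [SecondCountableTopologyEither E F] (μ : Measure E)
    [IsFiniteMeasure μ] (κ : Kernel E F) [IsMarkovKernel κ] (L : StrongDual ℝ (E × F)) :
    charFunDual (μ ⊗ₘ κ) L = ∫ x, Complex.exp (L (x, 0) * Complex.I) *
      charFunDual (κ x) (L.comp (.inr ℝ E F)) ∂μ := by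
  have hL (x : E) (y : F) : L (x, y) = L (x, 0) + L.comp (.inr ℝ E F) y := by simp [← map_add]
  rw [charFunDual_apply, Measure.integral_compProd]
  · congr with x
    rw [charFunDual_apply, ← integral_const_mul]
    congr with y
    rw [hL, Complex.ofReal_add, add_mul, Complex.exp_add]
  · exact .of_bound (Continuous.aestronglyMeasurable (by fun_prop)) 1
      (ae_of_all _ fun z => (Complex.norm_exp_ofReal_mul_I _).le)

theorem stronglyMeasurable_charFunDual_kernel {α : Type*} [MeasurableSpace α] (κ : Kernel α E)
    (L : StrongDual ℝ E) :
    StronglyMeasurable fun x => charFunDual (κ x) L := by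
  simp only [charFunDual_apply]
  exact StronglyMeasurable.integral_kernel (Continuous.stronglyMeasurable (by fun_prop))

variable {Ω : ℕ → Type*} [∀ n, MeasurableSpace (Ω n)] {P : (n : ℕ) → Measure (Ω n)}
  [∀ n, IsProbabilityMeasure (P n)] {Ω' : Type*} [MeasurableSpace Ω'] {P' : Measure Ω'}
  [IsProbabilityMeasure P']

theorem tendstoInDistribution_prodMk_of_condCharFunDual
    [FiniteDimensional ℝ E] [FiniteDimensional ℝ F]
    {X : (n : ℕ) → Ω n → E} {Y : (n : ℕ) → Ω n → F} {κ : ℕ → Kernel E F} [∀ n, IsMarkovKernel (κ n)]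
    {Z : Ω' → E} {W : Ω' → F} {κ₀ : Kernel E F} [IsMarkovKernel κ₀]
    (hX : TendstoInDistribution X atTop Z P P')
    (hY : ∀ n, HasCondDistrib (Y n) (X n) (κ n) (P n)) (hW : HasCondDistrib W Z κ₀ P')
    (hκ : ∀ L, TendstoUniformly (fun n x => charFunDual (κ n x) L)
      (fun x => charFunDual (κ₀ x) L) atTop)
    (hκ₀ : ∀ L, Continuous fun x => charFunDual (κ₀ x) L) :
    TendstoInDistribution (fun n ω => (X n ω, Y n ω)) atTop (fun ω => (Z ω, W ω)) P P' := by
  refine ⟨fun n => (hY n).aemeasurable, hW.aemeasurable, tendsto_of_tendsto_charFunDual fun L => ?_⟩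
  have (n : ℕ) := Measure.isProbabilityMeasure_map (hX.forall_aemeasurable n)
  have := Measure.isProbabilityMeasure_map hX.aemeasurable_limit
  simp only [ProbabilityMeasure.coe_mk, (hY _).map_eq, hW.map_eq, charFunDual_compProd]
  let phase : E → ℂ := fun x => Complex.exp (L (x, 0) * Complex.I)
  have norm_phase (x : E) : ‖phase x‖ = 1 := Complex.norm_exp_ofReal_mul_I _
  have continuous_phase : Continuous phase := by fun_prop
  have norm_le_one (η : Kernel E F) [IsMarkovKernel η] (x : E) :
      ‖phase x * charFunDual (η x) (L.comp (.inr ℝ E F))‖ ≤ 1 := by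
    simpa [norm_phase] using norm_charFunDual_le_one (η x) _
  refine tendsto_integral_of_tendstoUniformly hX.tendsto
    (f := .ofNormedAddCommGroup _ (continuous_phase.mul (hκ₀ _)) 1 (norm_le_one κ₀))
    (fun n => Integrable.of_bound (μ := (P n).map (X n)) (continuous_phase.aestronglyMeasurable.mul
      (stronglyMeasurable_charFunDual_kernel (κ n) _).aestronglyMeasurable) 1
        (ae_of_all _ (norm_le_one (κ n)))) (Metric.tendstoUniformly_iff.2 fun ε hε => ?_)
  filter_upwards [Metric.tendstoUniformly_iff.1 (hκ (L.comp (.inr ℝ E F))) ε hε] with n hn x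
  change dist (phase x * _) (phase x * _) < ε
  rw [dist_eq_norm, ← mul_sub, norm_mul, norm_phase, one_mul, ← dist_eq_norm]
  exact hn x

theorem tendstoInDistribution_of_condCharFunDual [FiniteDimensional ℝ E] {T : ℕ}
    {X : (n : ℕ) → ℕ → Ω n → E} {κ : ℕ → (t : ℕ) → Kernel (Fin t → E) E}
    [∀ n t, IsMarkovKernel (κ n t)]
    {Z : ℕ → Ω' → E} {κ₀ : (t : ℕ) → Kernel (Fin t → E) E} [∀ t, IsMarkovKernel (κ₀ t)]
    (hX : ∀ n, ∀ t < T, HasCondDistrib (X n t) (fun ω (i : Fin t) => X n i ω) (κ n t) (P n))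
    (hZ : ∀ t < T, HasCondDistrib (Z t) (fun ω (i : Fin t) => Z i ω) (κ₀ t) P')
    (hκ : ∀ t < T, ∀ L, TendstoUniformly (fun n x => charFunDual (κ n t x) L)
      (fun x => charFunDual (κ₀ t x) L) atTop)
    (hκ₀ : ∀ t < T, ∀ L, Continuous fun x => charFunDual (κ₀ t x) L) :
    TendstoInDistribution (fun n ω (i : Fin T) => X n i ω) atTop
      (fun ω (i : Fin T) => Z i ω) P P' := by
  induction T with
  | zero =>
    refine ⟨fun n => (measurable_of_subsingleton_codomain _).aemeasurable,
      (measurable_of_subsingleton_codomain _).aemeasurable,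
      tendsto_of_tendsto_charFunDual fun L => ?_⟩
    have (n : ℕ) : IsProbabilityMeasure ((P n).map fun ω (i : Fin 0) => X n i ω) :=
      Measure.isProbabilityMeasure_map (measurable_of_subsingleton_codomain _).aemeasurable
    have : IsProbabilityMeasure (P'.map fun ω (i : Fin 0) => Z i ω) :=
      Measure.isProbabilityMeasure_map (measurable_of_subsingleton_codomain _).aemeasurable
    obtain rfl : L = 0 := Subsingleton.elim _ _
    simp [charFunDual_apply]
  | succ t ih =>
    have past := ih (fun n i hi => hX n i (hi.trans t.lt_succ_self))
      (fun i hi => hZ i (hi.trans t.lt_succ_self)) (fun i hi => hκ i (hi.trans t.lt_succ_self))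
      (fun i hi => hκ₀ i (hi.trans t.lt_succ_self))
    have pair := tendstoInDistribution_prodMk_of_condCharFunDual past
      (fun n => hX n t t.lt_succ_self) (hZ t t.lt_succ_self) (hκ t t.lt_succ_self)
      (hκ₀ t t.lt_succ_self)
    have continuous_snoc : Continuous fun x : (Fin t → E) × E =>
        (Fin.snoc x.1 x.2 : Fin (t + 1) → E) :=
      continuous_fst.finSnoc (A := fun _ => E) continuous_snd
    exact (pair.continuous_comp continuous_snoc).congr
      (fun n => ae_of_all _ fun ω => Fin.snoc_init_self fun i => X n i ω)
      (ae_of_all _ fun ω => Fin.snoc_init_self fun i => Z i ω)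

end WeakConvergence

section ExponentialLimit

theorem tendsto_pow_exp_of_tendsto_mul_sub_one {α : Type*} {l : Filter α} {m : α → ℕ}
    (hm : Tendsto m l atTop) {w : α → ℂ} {c : ℂ}
    (h : Tendsto (fun n => (m n : ℂ) * (w n - 1)) l (𝓝 c)) :
    Tendsto (fun n => w n ^ m n) l (𝓝 (Complex.exp c)) := by
  have eventually_ne : ∀ᶠ n in l, (m n : ℂ) ≠ 0 := by
    filter_upwards [hm.eventually_ne_atTop 0] with n hn using Nat.cast_ne_zero.2 hn
  have tendsto_one : Tendsto w l (𝓝 1) := by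
    have inv_mul := ((tendsto_inv_atTop_nhds_zero_nat (𝕜 := ℂ)).comp hm).mul h
    rw [zero_mul] at inv_mul
    refine tendsto_sub_nhds_zero_iff.1 (inv_mul.congr' ?_)
    filter_upwards [eventually_ne] with n hn using inv_mul_cancel_left₀ hn _
  have log_sub_isLittleO : (fun n => Complex.log (w n) - (w n - 1)) =o[l] fun n => w n - 1 := by
    simpa [Function.comp_def] using
      (Complex.hasDerivAt_log Complex.one_mem_slitPlane).isLittleO.comp_tendsto tendsto_one
  have mul_log_sub : Tendsto (fun n => m n * (Complex.log (w n) - (w n - 1))) l (𝓝 0) :=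
    (Asymptotics.isLittleO_one_iff ℂ).1
      (((Asymptotics.isBigO_refl _ l).mul_isLittleO log_sub_isLittleO).trans_isBigO
        (h.isBigO_one ℂ))
  have mul_log : Tendsto (fun n => m n * Complex.log (w n)) l (𝓝 c) := by
    simpa [← mul_add] using mul_log_sub.add h
  refine ((Complex.continuous_exp.tendsto c).comp mul_log).congr' ?_
  filter_upwards [tendsto_one.eventually_ne one_ne_zero] with n hn
  rw [Function.comp_apply, Complex.exp_nat_mul, Complex.exp_log hn]

theorem tendstoUniformly_stdSimplex_pow_exp {α ι : Type*} [Fintype ι] {l : Filter α} {m : α → ℕ}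
    (hm : Tendsto m l atTop) {w : α → ι → ℂ} {c : ι → ℂ}
    (h : ∀ i, Tendsto (fun n => (m n : ℂ) * (w n i - 1)) l (𝓝 (c i))) :
    TendstoUniformly (fun n (p : stdSimplex ℝ ι) => (∑ i, (p.1 i : ℂ) * w n i) ^ m n)
      (fun p => Complex.exp (∑ i, (p.1 i : ℂ) * c i)) l := by
  have coord (i : ι) : Continuous fun p : stdSimplex ℝ ι => (p.1 i : ℂ) :=
    Complex.continuous_ofReal.comp ((continuous_apply i).comp continuous_subtype_val)
  have continuous_limit : Continuous fun p : stdSimplex ℝ ι =>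
      Complex.exp (∑ i, (p.1 i : ℂ) * c i) := by fun_prop
  -- On a compact space, convergence along `(n, q)` as `q → p` for each `p` is uniform convergence.
  rw [← tendstoLocallyUniformly_iff_tendstoUniformly_of_compactSpace,
    tendstoLocallyUniformly_iff_forall_tendsto]
  intro p
  refine Tendsto.mono_right (Tendsto.prodMk_nhds (x := Complex.exp (∑ i, (p.1 i : ℂ) * c i))
    ((continuous_limit.tendsto p).comp tendsto_snd)
      (tendsto_pow_exp_of_tendsto_mul_sub_one (hm.comp tendsto_fst) ?_)) (nhds_le_uniformity _)
  have mul_sum_sub_one (n : α) (q : stdSimplex ℝ ι) :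
      (m n : ℂ) * (∑ i, (q.1 i : ℂ) * w n i - 1) = ∑ i, (q.1 i : ℂ) * (m n * (w n i - 1)) := by
    have sum_eq_one : ∑ i, (q.1 i : ℂ) = 1 := mod_cast q.2.2
    simp_rw [mul_left_comm _ (m n : ℂ), ← Finset.mul_sum, mul_sub (_ : ℂ) _ (1 : ℂ), mul_one,
      Finset.sum_sub_distrib, sum_eq_one, mul_sub, mul_one]
  simp only [Function.comp_apply, mul_sum_sub_one]
  exact tendsto_finsetSum _ fun i _ =>
    (((coord i).tendsto p).comp tendsto_snd).mul ((h i).comp tendsto_fst)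

end ExponentialLimit

section SecondOrderExpansion

theorem tendsto_natCast_mul_exp_div_sub_one (z : ℂ) :
    Tendsto (fun n : ℕ => (n : ℂ) * (Complex.exp (z / n) - 1)) atTop (𝓝 z) := by
  have hderiv : HasDerivAt (fun x : ℝ => Complex.exp (x * z)) z 0 := by
    simpa using ((hasDerivAt_id (0 : ℝ)).ofReal_comp.mul_const z).cexp
  refine (hderiv.tendsto_slope_zero_right.comp
    (tendsto_inv_atTop_nhdsGT_zero.comp tendsto_natCast_atTop_atTop)).congr fun n => ?_
  simp [div_eq_inv_mul]

variable {Ω : Type*} [MeasurableSpace Ω] {P : Measure Ω} [IsProbabilityMeasure P] {X : Ω → ℝ}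

theorem charFun_map_sub_taylor_isLittleO (hX : MemLp X 2 P) :
    (fun t : ℝ => charFun (P.map X) t -
      (1 + (P[X] : ℝ) * t * Complex.I - (P[X ^ 2] : ℝ) * t ^ 2 / 2)) =o[𝓝 0] fun t => t ^ 2 := by
  have := Measure.isProbabilityMeasure_map hX.aemeasurable
  have memLp_id : MemLp id 2 (P.map X) :=
    (memLp_map_measure_iff aestronglyMeasurable_id hX.aemeasurable).2 hX
  simpa only [taylorWithinEval_charFun_two_zero hX.aemeasurable memLp_id, sub_zero] using
    taylor_isLittleO_univ (x₀ := 0) (n := 2) (contDiff_charFun memLp_id)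

theorem tendsto_natCast_mul_charFun_map_sub_one (hX : MemLp X 2 P) (hmean : P[X] = 0) (x : ℝ) :
    Tendsto (fun n : ℕ => (n : ℂ) * (charFun (P.map X) (x / √n) - 1)) atTop
      (𝓝 (-(Var[X; P] * x ^ 2 / 2))) := by
  have tendsto_zero : Tendsto (fun n : ℕ => x / √n) atTop (𝓝 0) :=
    (Real.tendsto_sqrt_atTop.comp tendsto_natCast_atTop_atTop).const_div_atTop x
  have sq_div (n : ℕ) : (x / √n) ^ 2 = x ^ 2 * (n : ℝ)⁻¹ := by
    rw [div_pow, Real.sq_sqrt n.cast_nonneg, div_eq_mul_inv]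
  have second_moment : P[X ^ 2] = Var[X; P] :=
    (variance_of_integral_eq_zero hX.aemeasurable hmean).symm
  have remainder : (fun n : ℕ => charFun (P.map X) (x / √n) -
      (1 - (Var[X; P] : ℂ) * x ^ 2 / 2 / n)) =o[atTop] fun n : ℕ => (n : ℂ)⁻¹ := by
    rw [← Asymptotics.isLittleO_norm_right]
    refine Asymptotics.IsLittleO.of_const_mul_right (c := x ^ 2)
      (((charFun_map_sub_taylor_isLittleO hX).comp_tendsto tendsto_zero).congr
        (fun n => ?_) fun n => ?_)
    · have := congrArg Complex.ofReal (sq_div n)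
      push_cast at this
      simp only [Function.comp_apply, hmean, second_moment, Complex.ofReal_div, this]
      push_cast
      ring
    · simp [sq_div]
  have limit := remainder.tendsto_div_nhds_zero.sub_const ((Var[X; P] : ℂ) * x ^ 2 / 2)
  rw [zero_sub] at limit
  refine limit.congr' ?_
  filter_upwards [eventually_ne_atTop 0] with n hn
  field_simp
  ring

theorem tendsto_natCast_mul_charFun_map_const_add_sub_one (hX : MemLp X 2 P) (hmean : P[X] = 0)
    (h x : ℝ) :
    Tendsto (fun n : ℕ => (n : ℂ) * (charFun (P.map fun ω => h / √n + X ω) (x / √n) - 1)) atTop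
      (𝓝 (h * x * Complex.I - Var[X; P] * x ^ 2 / 2)) := by
  have := Measure.isProbabilityMeasure_map hX.aemeasurable
  have charFun_eq (n : ℕ) : charFun (P.map fun ω => h / √n + X ω) (x / √n) =
      charFun (P.map X) (x / √n) * Complex.exp (h * x * Complex.I / n) := by
    have map_eq : (P.map fun ω => h / √n + X ω) = (P.map X).map (h / √n + ·) :=
      (AEMeasurable.map_map_of_aemeasurable (by fun_prop) hX.aemeasurable).symm
    have inner_eq : inner ℝ (h / √n) (x / √n) = h * x / n := by
      rw [RCLike.inner_apply', conj_trivial, div_mul_div_comm, Real.mul_self_sqrt n.cast_nonneg]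
    rw [map_eq, charFun_map_const_add, inner_eq]
    push_cast
    rw [div_mul_eq_mul_div]
  have tendsto_one : Tendsto (fun n : ℕ => charFun (P.map X) (x / √n)) atTop (𝓝 1) := by
    have := continuous_charFun.tendsto' (f := charFun (P.map X)) 0 1 (by simp)
    exact this.comp
      ((Real.tendsto_sqrt_atTop.comp tendsto_natCast_atTop_atTop).const_div_atTop x)
  have limit := (tendsto_one.mul (tendsto_natCast_mul_exp_div_sub_one (h * x * Complex.I))).add
    (tendsto_natCast_mul_charFun_map_sub_one hX hmean x)
  rw [one_mul, ← sub_eq_add_neg] at limit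
  refine limit.congr fun n => ?_
  rw [charFun_eq]
  ring

end SecondOrderExpansion

section BatchMeans

variable {K : ℕ}

theorem charFunDual_map_sum_pi_const {ι α E : Type*} [Fintype ι] [MeasurableSpace α]
    [NormedAddCommGroup E] [NormedSpace ℝ E] [MeasurableSpace E] [BorelSpace E]
    [SecondCountableTopology E] (μ : Measure α) [IsProbabilityMeasure μ] {f : α → E}
    (hf : Measurable f) (L : StrongDual ℝ E) :
    charFunDual ((Measure.pi fun _ : ι => μ).map fun y => ∑ i, f (y i)) L =
      charFunDual (μ.map f) L ^ Fintype.card ι := by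
  have := Measure.isProbabilityMeasure_map (μ := μ) hf.aemeasurable
  have map_pi : (Measure.pi fun _ : ι => μ).map (fun y i => f (y i)) =
      Measure.pi fun _ : ι => μ.map f :=
    Measure.pi_map_pi fun _ => hf.aemeasurable
  have map_sum : (Measure.pi fun _ : ι => μ).map (fun y => ∑ i, f (y i)) =
      (Measure.pi fun _ : ι => μ.map f).map fun z => ∑ i, z i := by
    rw [← map_pi, Measure.map_map (by fun_prop) (by fun_prop)]
    rfl
  rw [map_sum, charFunDual_map_sum_pi_eq_prod, Finset.prod_apply, Finset.prod_const,
    Finset.card_univ]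

theorem integral_armLaw (p : stdSimplex ℝ (Fin K)) (f : Fin K → ℂ) :
    ∫ a, f a ∂(armLaw p) = ∑ a, (p.1 a : ℂ) * f a := by
  rw [armLaw, integral_finsetSum_measure fun a _ =>
    (Integrable.of_finite (μ := Measure.dirac a)).smul_measure ENNReal.ofReal_ne_top]
  refine Finset.sum_congr rfl fun a _ => ?_
  rw [integral_smul_measure, integral_dirac, ENNReal.toReal_ofReal (p.2.1 a), Complex.real_smul]

theorem charFunDual_map_armLaw_prod {α E : Type*} [MeasurableSpace α] [NormedAddCommGroup E]
    [NormedSpace ℝ E] [MeasurableSpace E] [BorelSpace E] (p : stdSimplex ℝ (Fin K))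
    (ν : Measure α) [IsFiniteMeasure ν] {f : Fin K × α → E}
    (hf : Measurable f) (L : StrongDual ℝ E) :
    charFunDual (((armLaw p).prod ν).map f) L =
      ∑ a, (p.1 a : ℂ) * charFunDual (ν.map fun e => f (a, e)) L := by
  have character_stronglyMeasurable : StronglyMeasurable fun x => Complex.exp (L x * Complex.I) :=
    Continuous.stronglyMeasurable (by fun_prop)
  rw [charFunDual_apply,
    integral_map hf.aemeasurable character_stronglyMeasurable.aestronglyMeasurable,
    integral_prod (fun z => Complex.exp (L (f z) * Complex.I)) (.of_bound
      (character_stronglyMeasurable.comp_measurable hf).aestronglyMeasurable 1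
      (ae_of_all _ fun z => (Complex.norm_exp_ofReal_mul_I _).le)), integral_armLaw]
  congr with a
  have section_measurable : Measurable fun e => f (a, e) := hf.comp measurable_prodMk_left
  rw [charFunDual_apply, integral_map section_measurable.aemeasurable
    character_stronglyMeasurable.aestronglyMeasurable]

theorem charFunDual_real (μ : Measure ℝ) (L : StrongDual ℝ ℝ) :
    charFunDual μ L = charFun μ (L 1) := by
  rw [charFunDual_apply, charFun_apply_real]
  congr with x
  have map_eq : L x = L 1 * x := by simpa [mul_comm] using L.map_smul x 1
  rw [map_eq, Complex.ofReal_mul]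

/-- The vector which a unit `z = (assigned arm, noise vector)` adds to the scaled batch mean: only
the entry of the assigned arm is nonzero. -/
noncomputable def contribution (b : ℕ → PosReal) (h : Fin K → ℝ) (n t : ℕ)
    (z : Fin K × (Fin K → ℝ)) : Fin K → ℝ :=
  (reward h n z.2 z.1 / (b t * √n)) • Pi.single z.1 1

theorem scaledMean_eq_sum_contribution (b : ℕ → PosReal) (h : Fin K → ℝ) (n t : ℕ)
    (y : Fin (batchSize b n t) → Fin K × (Fin K → ℝ)) :
    scaledMean b h n t y = ∑ j, contribution b h n t (y j) := by
  ext a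
  simp only [scaledMean, Finset.mul_sum, Finset.sum_apply]
  congr with j
  rcases eq_or_ne (y j).1 a with rfl | ha
  · simp [contribution, div_eq_inv_mul]
  · simp [contribution, ha]

theorem measurable_contribution (b : ℕ → PosReal) (h : Fin K → ℝ) (n t : ℕ) :
    Measurable (contribution b h n t) :=
  measurable_from_prod_countable_right fun a =>
    Continuous.measurable (by unfold contribution reward; fun_prop)

theorem measurable_scaledMean (b : ℕ → PosReal) (h : Fin K → ℝ) (n t : ℕ) :
    Measurable (scaledMean b h n t) := by
  simp only [funext (scaledMean_eq_sum_contribution b h n t)]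
  have := measurable_contribution b h n t
  fun_prop

theorem charFunDual_map_contribution (b : ℕ → PosReal) (h : Fin K → ℝ) (n t : ℕ)
    (ν : Measure (Fin K → ℝ)) (L : StrongDual ℝ (Fin K → ℝ)) (a : Fin K) :
    charFunDual (ν.map fun e => contribution b h n t (a, e)) L =
      charFun (ν.map fun e => reward h n e a) (L (Pi.single a 1) / b t / √n) := by
  let embedding : ℝ →L[ℝ] Fin K → ℝ := .toSpanSingleton ℝ ((b t * √n : ℝ)⁻¹ • Pi.single a 1)
  have contribution_eq : (fun e => contribution b h n t (a, e)) =
      embedding ∘ fun e => reward h n e a := by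
    ext e : 1
    simp [contribution, embedding, div_eq_mul_inv, mul_smul]
  have measurable_reward : Measurable fun e : Fin K → ℝ => reward h n e a :=
    Continuous.measurable (by unfold reward; fun_prop)
  rw [contribution_eq, ← Measure.map_map embedding.continuous.measurable measurable_reward,
    charFunDual_map, charFunDual_real]
  congr 1
  simp [embedding, div_eq_mul_inv, mul_assoc, mul_comm, mul_left_comm]

theorem charFunDual_map_scaledMean_unitKernel (s : Fin K → PosReal) (b : ℕ → PosReal)
    (π : ContinuousPolicy K) (x₀ : State K) (h : Fin K → ℝ) (ν : Measure (Fin K → ℝ))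
    [IsProbabilityMeasure ν] (n t : ℕ) (r : Fin t → Fin K → ℝ) (L : StrongDual ℝ (Fin K → ℝ)) :
    charFunDual (((piKernel fun _ => unitKernel s b π x₀ ν t).map (scaledMean b h n t)) r) L =
      (∑ a, ((allocation s b π x₀ t r).1 a : ℂ) * charFun (ν.map fun e => reward h n e a)
        (L (Pi.single a 1) / b t / √n)) ^ batchSize b n t := by
  have unit_law : unitKernel s b π x₀ ν t r = (armLaw (allocation s b π x₀ t r)).prod ν := by
    rw [unitKernel, Kernel.prod_apply, Kernel.const_apply]
    rfl
  have batch_law : (piKernel fun _ : Fin (batchSize b n t) => unitKernel s b π x₀ ν t) r =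
      Measure.pi fun _ => (armLaw (allocation s b π x₀ t r)).prod ν := by
    rw [← unit_law]
    rfl
  rw [Kernel.map_apply _ (measurable_scaledMean b h n t), batch_law,
    funext (scaledMean_eq_sum_contribution b h n t),
    charFunDual_map_sum_pi_const _ (measurable_contribution b h n t),
    charFunDual_map_armLaw_prod _ _ (measurable_contribution b h n t), Fintype.card_fin]
  simp only [charFunDual_map_contribution]

/-- The exponent, per unit of allocation to arm `a`, of the characteristic function of the Gaussian
limit at the functional `x ↦ ∑ a, v a * x a`. -/
noncomputable def armCumulant (s : Fin K → PosReal) (b : ℕ → PosReal) (h v : Fin K → ℝ) (t : ℕ)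
    (a : Fin K) : ℂ :=
  h a * v a * Complex.I - (s a : ℝ) ^ 2 * v a ^ 2 / (2 * (b t : ℝ))

theorem charFunDual_gaussianArmKernel (s : Fin K → PosReal) (b : ℕ → PosReal)
    (π : ContinuousPolicy K) (x₀ : State K) (h : Fin K → ℝ) (t : ℕ) (r : Fin t → Fin K → ℝ)
    (L : StrongDual ℝ (Fin K → ℝ)) :
    charFunDual ((piKernel fun a => gaussianArmKernel s b π x₀ h t a) r) L =
      Complex.exp (∑ a, ((allocation s b π x₀ t r).1 a : ℂ) *
        armCumulant s b h (fun a => L (Pi.single a 1)) t a) := by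
  change charFunDual (Measure.pi fun a => gaussianReal _ _) L = _
  rw [charFunDual_pi, Complex.exp_sum]
  congr with a
  have variance_nonneg : 0 ≤ (allocation s b π x₀ t r).1 a * (s a : ℝ) ^ 2 / b t :=
    div_nonneg (mul_nonneg ((allocation s b π x₀ t r).2.1 a) (sq_nonneg _)) (b t).2.le
  have hb : ((b t : ℝ) : ℂ) ≠ 0 := mod_cast (b t).2.ne'
  rw [charFunDual_real, charFun_gaussianReal, Real.coe_toNNReal _ variance_nonneg, armCumulant]
  congr 1
  simp only [ContinuousLinearMap.comp_apply, ContinuousLinearMap.single_apply]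
  push_cast
  field_simp

theorem tendsto_batchSize (b : ℕ → PosReal) (t : ℕ) :
    Tendsto (fun n => batchSize b n t) atTop atTop :=
  tendsto_nat_floor_atTop.comp (tendsto_natCast_atTop_atTop.const_mul_atTop (b t).2)

theorem tendsto_batchSize_div (b : ℕ → PosReal) (t : ℕ) :
    Tendsto (fun n : ℕ => (batchSize b n t : ℝ) / n) atTop (𝓝 (b t)) :=
  (tendsto_nat_floor_mul_div_atTop (b t).2.le).comp tendsto_natCast_atTop_atTop

theorem tendsto_batchSize_mul_charFun_reward_sub_one {s : Fin K → PosReal} (b : ℕ → PosReal)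
    (h v : Fin K → ℝ) {ν : Measure (Fin K → ℝ)} [IsProbabilityMeasure ν] (t : ℕ) {a : Fin K}
    (hmean : ∫ e, e a ∂ν = 0) (hvar : Var[fun e => e a; ν] = (s a : ℝ) ^ 2) :
    Tendsto (fun n : ℕ => (batchSize b n t : ℂ) *
      (charFun (ν.map fun e => reward h n e a) (v a / b t / √n) - 1)) atTop
      (𝓝 (armCumulant s b h v t a)) := by
  have memLp : MemLp (fun e : Fin K → ℝ => e a) 2 ν :=
    memLp_two_of_variance_ne_zero (Measurable.aestronglyMeasurable (by fun_prop))
      (hvar ▸ (pow_pos (s a).2 2).ne')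
  have limit := ((Complex.continuous_ofReal.tendsto _).comp (tendsto_batchSize_div b t)).mul
    (tendsto_natCast_mul_charFun_map_const_add_sub_one memLp hmean (h a) (v a / b t))
  have hb : ((b t : ℝ) : ℂ) ≠ 0 := mod_cast (b t).2.ne'
  have limit_eq : ((b t : ℝ) : ℂ) * (h a * (v a / b t : ℝ) * Complex.I -
      Var[fun e => e a; ν] * (v a / b t : ℝ) ^ 2 / 2) = armCumulant s b h v t a := by
    rw [hvar, armCumulant]
    push_cast
    field_simp
  rw [limit_eq] at limit
  refine limit.congr' ?_
  filter_upwards [eventually_ne_atTop 0] with n hn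
  have hn' : (n : ℂ) ≠ 0 := mod_cast hn
  simp only [Function.comp_apply, Complex.ofReal_div, Complex.ofReal_natCast, ← mul_assoc,
    div_mul_cancel₀ _ hn']
  rfl

theorem continuous_allocation (s : Fin K → PosReal) (b : ℕ → PosReal) (π : ContinuousPolicy K)
    (x₀ : State K) (t : ℕ) : Continuous (allocation s b π x₀ t) :=
  (π t).continuous.comp (continuous_posterior s b π x₀ t)

theorem tendstoInDistribution_scaledMean {T : ℕ} {s : Fin K → PosReal} {b : ℕ → PosReal}
    {π : ContinuousPolicy K} {x₀ : State K} {h : Fin K → ℝ} {ν : Measure (Fin K → ℝ)}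
    [IsProbabilityMeasure ν] (hmean : ∀ a, ∫ e, e a ∂ν = 0)
    (hvar : ∀ a, Var[fun e => e a; ν] = (s a : ℝ) ^ 2)
    {Ω : ℕ → Type*} [∀ n, MeasurableSpace (Ω n)] {P : (n : ℕ) → Measure (Ω n)}
    [∀ n, IsProbabilityMeasure (P n)]
    {Y : (n t : ℕ) → Ω n → Fin (batchSize b n t) → Fin K × (Fin K → ℝ)}
    (hY : ∀ n, IsBatchedExperiment s b π x₀ h ν T n (Y n) (P n))
    {Ω' : Type*} [MeasurableSpace Ω'] {P' : Measure Ω'} [IsProbabilityMeasure P']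
    {G : ℕ → Ω' → Fin K → ℝ} (hG : IsGaussianExperiment s b π x₀ h T G P') :
    TendstoInDistribution (fun n ω (i : Fin T) => scaledMean b h n i (Y n i ω)) atTop
      (fun ω (i : Fin T) => G i ω) P P' := by
  have (n t : ℕ) : IsMarkovKernel
      ((piKernel fun _ => unitKernel s b π x₀ ν t).map (scaledMean b h n t)) :=
    Kernel.IsMarkovKernel.map _ (measurable_scaledMean b h n t)
  refine tendstoInDistribution_of_condCharFunDual
    (X := fun n t ω => scaledMean b h n t (Y n t ω))
    (fun n t ht => (hY n t ht).comp_left (measurable_scaledMean b h n t)) hG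
    (fun t _ L => ?_) (fun t _ L => ?_)
  · simp only [charFunDual_map_scaledMean_unitKernel, charFunDual_gaussianArmKernel]
    exact (tendstoUniformly_stdSimplex_pow_exp (tendsto_batchSize b t) fun a =>
      tendsto_batchSize_mul_charFun_reward_sub_one b h (fun a => L (Pi.single a 1)) t (hmean a)
        (hvar a)).comp (allocation s b π x₀ t)
  · simp only [charFunDual_gaussianArmKernel]
    have coord (a : Fin K) : Continuous fun r => (allocation s b π x₀ t r).1 a :=
      (continuous_apply a).comp
        (continuous_subtype_val.comp (continuous_allocation s b π x₀ t))
    fun_prop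

end BatchMeans

end BatchedExperiment

theorem mainTheorem9_general {K T : ℕ}
    (s : Fin K → BatchedExperiment.PosReal) (b : ℕ → BatchedExperiment.PosReal)
    (π : BatchedExperiment.ContinuousPolicy K) (x₀ : BatchedExperiment.State K)
    (h : Fin K → ℝ)
    (ν : Measure (Fin K → ℝ)) [IsProbabilityMeasure ν] (hmean : ∀ a, ∫ e, e a ∂ν = 0)
    (hvar : ∀ a, Var[fun e => e a; ν] = (s a : ℝ) ^ 2)
    {Ω : ℕ → Type*} [∀ n, MeasurableSpace (Ω n)] (P : (n : ℕ) → Measure (Ω n))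
    [∀ n, IsProbabilityMeasure (P n)]
    (Y : (n t : ℕ) → Ω n → Fin (BatchedExperiment.batchSize b n t) → Fin K × (Fin K → ℝ))
    (hY : ∀ n, BatchedExperiment.IsBatchedExperiment s b π x₀ h ν T n (Y n) (P n))
    {Ω' : Type*} [MeasurableSpace Ω'] (P' : Measure Ω') [IsProbabilityMeasure P']
    (G : ℕ → Ω' → Fin K → ℝ)
    (hG : BatchedExperiment.IsGaussianExperiment s b π x₀ h T G P') :
    TendstoInDistribution
      (fun n ω (t : Fin T) => BatchedExperiment.posterior s b π x₀ t
        fun i : Fin t => BatchedExperiment.scaledMean b h n i (Y n i ω))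
      atTop
      (fun ω (t : Fin T) => BatchedExperiment.posterior s b π x₀ t fun i : Fin t => G i ω)
      P P' := by
  have continuous_states : Continuous fun (r : Fin T → Fin K → ℝ) (t : Fin T) =>
      BatchedExperiment.posterior s b π x₀ t fun i : Fin t => r (i.castLE t.2.le) :=
    continuous_pi fun t => (BatchedExperiment.continuous_posterior s b π x₀ t).comp
      (continuous_pi fun i => continuous_apply _)
  exact (BatchedExperiment.tendstoInDistribution_scaledMean hmean hvar hY hG).continuous_comp
    continuous_states

theorem mainTheorem9 {K T : ℕ}
    (s : Fin K → BatchedExperiment.PosReal) (b : ℕ → BatchedExperiment.PosReal)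
    (π : BatchedExperiment.ContinuousPolicy K) (x₀ : BatchedExperiment.State K)
    (h : Fin K → ℝ)
    (ν : Measure (Fin K → ℝ)) [IsProbabilityMeasure ν] (hν : BatchedExperiment.IsNoiseLaw s ν)
    {Ω : ℕ → Type*} [∀ n, MeasurableSpace (Ω n)] (P : (n : ℕ) → Measure (Ω n))
    [∀ n, IsProbabilityMeasure (P n)]
    (Y : (n t : ℕ) → Ω n → Fin (BatchedExperiment.batchSize b n t) → Fin K × (Fin K → ℝ))
    (hY : ∀ n, BatchedExperiment.IsBatchedExperiment s b π x₀ h ν T n (Y n) (P n))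
    {Ω' : Type*} [MeasurableSpace Ω'] (P' : Measure Ω') [IsProbabilityMeasure P']
    (G : ℕ → Ω' → Fin K → ℝ)
    (hG : BatchedExperiment.IsGaussianExperiment s b π x₀ h T G P') :
    TendstoInDistribution
      (fun n ω (t : Fin T) => BatchedExperiment.posterior s b π x₀ t
        fun i : Fin t => BatchedExperiment.scaledMean b h n i (Y n i ω))
      atTop
      (fun ω (t : Fin T) => BatchedExperiment.posterior s b π x₀ t fun i : Fin t => G i ω)
      P P' :=
  mainTheorem9_general s b π x₀ h ν hν.mean hν.variance P Y hY P' G hG
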